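/- Let $d\in\mathbb N$, let $\mu_1,\dots,\mu_d$ be Borel probability measures on $\mathbb R^d$, and suppose that there are exponents $p_1,\dots,p_d\in(1,+\infty)$ with $$\sum_{i=1}^d \frac1{p_i}=1\qquad\text{and}\qquad \sum_{i=1}^d\int_{\mathbb R^d}\frac{|x|^{p_i}}{p_i}\,d\mu_i(x)<+\infty .$$ (These conditions force $d\ge 2$.) Let $\Pi(\mu_1,\dots,\mu_d)$ be the set of probability measures on $(\mathbb R^d)^d$ with marginals $\mu_1,\dots,\mu_d$, and consider $$(\mathrm{MK})\qquad \sup_{\gamma\in\Pi(\mu_1,\dots,\mu_d)}\int_{(\mathbb R^d)^d}\det(x_1,\dots,x_d)\,d\gamma(x_1,\dots,x_d)$$ and $$(\mathrm{D})\qquad \inf_{(\phi_1,\dots,\phi_d)\in\mathcal E}\ \sum_{i=1}^d\int_{\mathbb R^d}\phi_i\,d\mu_i ,$$ where $\mathcal E$ is the set of $d$-tuples of lower semicontinuous functions $\phi_i:\mathbb R^d\to\mathbb R\cup\{+\infty\}$ such that $$\sum_{i=1}^d\phi_i(x_i)\ \ge\ \det(x_1,\dots,x_d)\qquad\text{for all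 }(x_1,\dots,x_d)\in(\mathbb R^d)^d ,$$ and where the objective of $(\mathrm{D})$ is understood to be $+\infty$ whenever $\int\phi_i^+\,d\mu_i=+\infty$ for some $i$. Then $\det$ is $\gamma$-integrable for every $\gamma\in\Pi(\mu_1,\dots,\mu_d)$, the problem $(\mathrm{MK})$ has a maximizer, the problem $(\mathrm{D})$ has a minimizer, and $$\max(\mathrm{MK})=\min(\mathrm{D}).$$ Moreover, $(\mathrm{D})$ has a minimizer $(\phi_1,\dots,\phi_d)\in\mathcal E$ such that, for all $i=1,\dots,d$ and all $x_i\in\mathbb R^d$, $$\phi_i(x_i)=\sup_{(x_j)_{j\ne i}\in(\mathbb R^d)^{d-1}}\Big\{\det(x_1,\dots,x_d)-\sum_{j\ne i}\phi_j(x_j)\Big\}.$$ -/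

import Mathlib

open MeasureTheory

noncomputable section

namespace DetTransport

/-- `ℝ^d` with its Euclidean norm and Borel σ-algebra. -/
abbrev E (d : ℕ) : Type := EuclideanSpace ℝ (Fin d)

/-- `det (x_1, …, x_d)`: the determinant of the matrix whose columns are the vectors `x_j`. -/
def detVec {d : ℕ} (x : Fin d → E d) : ℝ :=
  Matrix.det (Matrix.of fun i j : Fin d => x j i)

/-- `Π(μ_1, …, μ_d)`: the probability measures on `(ℝ^d)^d` with marginals `μ_1, …, μ_d`. -/
def couplings {d : ℕ} (μ : Fin d → Measure (E d)) : Set (Measure (Fin d → E d)) :=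
  {γ | IsProbabilityMeasure γ ∧ ∀ i, γ.map (fun x => x i) = μ i}

/-- The value of `(MK)`: the supremum of `∫ det dγ` over all couplings `γ`. -/
def mkValue {d : ℕ} (μ : Fin d → Measure (E d)) : EReal :=
  ⨆ γ ∈ couplings μ, ((∫ x, detVec x ∂γ : ℝ) : EReal)

/-- `γ` solves `(MK)`. -/
def IsMKSolution {d : ℕ} (μ : Fin d → Measure (E d)) (γ : Measure (Fin d → E d)) : Prop :=
  γ ∈ couplings μ ∧ ((∫ x, detVec x ∂γ : ℝ) : EReal) = mkValue μ

/-- The admissible class of the dual problem: tuples of lower semicontinuous functions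
`φ_i : ℝ^d → ℝ ∪ {+∞}` with `∑ φ_i(x_i) ≥ det (x_1, …, x_d)` everywhere. -/
def dualClass (d : ℕ) : Set (Fin d → E d → EReal) :=
  {φ | (∀ i, LowerSemicontinuous (φ i)) ∧ (∀ i x, φ i x ≠ ⊥) ∧
    ∀ x : Fin d → E d, ((detVec x : ℝ) : EReal) ≤ ∑ i, φ i (x i)}

/-- Total integral of the positive parts, `∑ ∫ φ_i⁺ dμ_i`. -/
def posCost {d : ℕ} (μ : Fin d → Measure (E d)) (φ : Fin d → E d → EReal) : ENNReal :=
  ∑ i, ∫⁻ x, (φ i x).toENNReal ∂(μ i)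

/-- Total integral of the negative parts, `∑ ∫ φ_i⁻ dμ_i`. -/
def negCost {d : ℕ} (μ : Fin d → Measure (E d)) (φ : Fin d → E d → EReal) : ENNReal :=
  ∑ i, ∫⁻ x, (-φ i x).toENNReal ∂(μ i)

open Classical in
/-- The dual objective `∑ ∫ φ_i dμ_i`, with value `+∞` as soon as one of the positive parts has
infinite integral (the usual convention `∞ - ∞ = +∞` of a minimization problem; the subtraction
of `EReal` would give `-∞`). -/
def dualCost {d : ℕ} (μ : Fin d → Measure (E d)) (φ : Fin d → E d → EReal) : EReal :=
  if posCost μ φ = ⊤ then ⊤ else (posCost μ φ : EReal) - (negCost μ φ : EReal)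

/-- The value of `(D)`: the infimum of the dual objective over the admissible class. -/
def dualValue {d : ℕ} (μ : Fin d → Measure (E d)) : EReal :=
  ⨅ φ ∈ dualClass d, dualCost μ φ

/-- `φ` solves `(D)`. -/
def IsDualSolution {d : ℕ} (μ : Fin d → Measure (E d)) (φ : Fin d → E d → EReal) : Prop :=
  φ ∈ dualClass d ∧ dualCost μ φ = dualValue μ

/-- The conjugacy relations
`φ_i(x_i) = sup_{(x_j)_{j ≠ i}} (det (x_1, …, x_d) - ∑_{j ≠ i} φ_j(x_j))` for all `i` and `x_i`;
the supremum runs over the tuples `y` whose `i`-th entry is the given point. -/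
def IsConjugate {d : ℕ} (φ : Fin d → E d → EReal) : Prop :=
  ∀ (i : Fin d) (x : E d),
    φ i x = ⨆ (y : Fin d → E d) (_ : y i = x),
      (((detVec y : ℝ) : EReal) - ∑ j ∈ Finset.univ.erase i, φ j (y j))

end DetTransport

end

/-! With h_i(x) = d! |x|^{p_i} / p_i, Young's inequality gives |det| ≤ ∑ h_i(x_i). Hence det is
integrable for every coupling and weak duality holds. It remains to find a coupling and a conjugate
tuple whose values meet; they meet at `realDualValue`, the dual infimum over integrable real tuples
with no semicontinuity imposed.

Primal side: this infimum is sublinear in the cost, on the space of all functions bounded by a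
multiple of ∑ (1 + h_i). Hahn–Banach yields a linear minorant exact at det
(`exists_linear_le_realDualValue`). Testing it against separated majorants shows that it is
positive, has vanishing tails and has the right marginals, so Riesz's theorem turns it into an
optimal coupling (`exists_coupling_integral_eq`).

Dual side: adding h_i and constants of zero sum makes a minimizing sequence nonnegative. Its infima
over a countable basis converge along a subsequence and define a lower semicontinuous tuple, still
admissible and controlled by Fatou (`exists_lowerSemicontinuous_limit`). After h_i is subtracted
again, conjugating one coordinate at a time (`Admissible.exists_isConjugate_le`) only lowers the
tuple, and conjugacy brings back semicontinuity. -/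

noncomputable section

namespace DetTransport

open Filter Topology
open scoped ENNReal

/-! ### Sublinearity of the dual value and a Hahn–Banach minorant -/

section HahnBanach

variable {ι X : Type*} [Fintype ι] [MeasurableSpace X]

/-- The tuples of integrable functions whose separated sum dominates `F`. -/
def realDualClass (μ : ι → Measure X) (F : (ι → X) → ℝ) : Set (ι → X → ℝ) :=
  {φ | (∀ i, Integrable (φ i) (μ i)) ∧ ∀ x, F x ≤ ∑ i, φ i (x i)}

/-- The infimum of `∑ ∫ φ_i dμ_i` over the integrable tuples whose separated sum dominates `F`. -/
def realDualValue (μ : ι → Measure X) (F : (ι → X) → ℝ) : ℝ :=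
  sInf ((fun φ : ι → X → ℝ => ∑ i, ∫ x, φ i x ∂(μ i)) '' realDualClass μ F)

/-- The functions dominated by a multiple of `G`. -/
def dominated {Y : Type*} (G : Y → ℝ) : Submodule ℝ (Y → ℝ) where
  carrier := {F | ∃ C : ℝ, ∀ y, |F y| ≤ C * G y}
  zero_mem' := ⟨0, fun y => by simp⟩
  add_mem' := by
    rintro F F' ⟨C, hC⟩ ⟨C', hC'⟩
    refine ⟨C + C', fun y => ?_⟩
    have := abs_add_le (F y) (F' y)
    simp only [Pi.add_apply]
    linarith [hC y, hC' y, add_mul C C' (G y)]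
  smul_mem' := by
    rintro c F ⟨C, hC⟩
    refine ⟨|c| * C, fun y => ?_⟩
    simp only [Pi.smul_apply, smul_eq_mul, abs_mul, mul_assoc]
    exact mul_le_mul_of_nonneg_left (hC y) (abs_nonneg c)

variable {μ : ι → Measure X} {g : ι → X → ℝ} {F F' : (ι → X) → ℝ}

theorem realDualClass_nonempty (hg : ∀ i, Integrable (g i) (μ i))
    (hF : F ∈ dominated fun x : ι → X => ∑ i, g i (x i)) : (realDualClass μ F).Nonempty := by
  obtain ⟨C, hC⟩ := hF
  refine ⟨fun i x => C * g i x, fun i => (hg i).const_mul C, fun x => ?_⟩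
  rw [← Finset.mul_sum]
  exact (le_abs_self _).trans (hC x)

theorem exists_lt_realDualValue_add (hg : ∀ i, Integrable (g i) (μ i))
    (hF : F ∈ dominated fun x : ι → X => ∑ i, g i (x i)) {ε : ℝ} (hε : 0 < ε) :
    ∃ φ ∈ realDualClass μ F, ∑ i, ∫ x, φ i x ∂(μ i) < realDualValue μ F + ε := by
  obtain ⟨_, ⟨φ, hφ, rfl⟩, h⟩ := exists_lt_of_csInf_lt
    ((realDualClass_nonempty hg hF).image _) (lt_add_of_pos_right (realDualValue μ F) hε)
  exact ⟨φ, hφ, h⟩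

variable [∀ i, IsProbabilityMeasure (μ i)]

/-- An integrable function on a probability space is somewhere at most its mean. Choosing such a
point in each coordinate gives the bound without any product measure. -/
theorem sum_integral_nonneg {φ : ι → X → ℝ} (hφ : ∀ i, Integrable (φ i) (μ i))
    (h : ∀ x : ι → X, 0 ≤ ∑ i, φ i (x i)) : 0 ≤ ∑ i, ∫ x, φ i x ∂(μ i) := by
  choose x hx using fun i => exists_le_integral (hφ i)
  exact (h x).trans (Finset.sum_le_sum fun i _ => hx i)

theorem sum_integral_mono {φ ψ : ι → X → ℝ} (hφ : ∀ i, Integrable (φ i) (μ i))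
    (hψ : ∀ i, Integrable (ψ i) (μ i)) (h : ∀ x : ι → X, ∑ i, φ i (x i) ≤ ∑ i, ψ i (x i)) :
    ∑ i, ∫ x, φ i x ∂(μ i) ≤ ∑ i, ∫ x, ψ i x ∂(μ i) := by
  have := sum_integral_nonneg (μ := μ) (φ := fun i => ψ i - φ i) (fun i => (hψ i).sub (hφ i))
    (fun x => by simpa [Finset.sum_sub_distrib] using h x)
  simp only [Pi.sub_apply] at this
  simp_rw [fun i => integral_sub (hψ i) (hφ i), Finset.sum_sub_distrib] at this
  linarith

theorem realDualClass_bddBelow (hg : ∀ i, Integrable (g i) (μ i))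
    (hF : F ∈ dominated fun x : ι → X => ∑ i, g i (x i)) :
    BddBelow ((fun φ : ι → X → ℝ => ∑ i, ∫ x, φ i x ∂(μ i)) '' realDualClass μ F) := by
  obtain ⟨C, hC⟩ := hF
  refine ⟨∑ i, ∫ x, -C * g i x ∂(μ i), ?_⟩
  rintro _ ⟨φ, hφ, rfl⟩
  refine sum_integral_mono (fun i => (hg i).const_mul (-C)) hφ.1 fun x => ?_
  rw [← Finset.mul_sum]
  linarith [hφ.2 x, neg_abs_le (F x), hC x]

theorem realDualValue_le (hg : ∀ i, Integrable (g i) (μ i))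
    (hF : F ∈ dominated fun x : ι → X => ∑ i, g i (x i)) {φ : ι → X → ℝ}
    (hφ : φ ∈ realDualClass μ F) : realDualValue μ F ≤ ∑ i, ∫ x, φ i x ∂(μ i) :=
  csInf_le (realDualClass_bddBelow hg hF) ⟨φ, hφ, rfl⟩

theorem realDualValue_add_le (hg : ∀ i, Integrable (g i) (μ i))
    (hF : F ∈ dominated fun x : ι → X => ∑ i, g i (x i))
    (hF' : F' ∈ dominated fun x : ι → X => ∑ i, g i (x i)) :
    realDualValue μ (F + F') ≤ realDualValue μ F + realDualValue μ F' := by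
  refine le_of_forall_pos_le_add fun ε hε => ?_
  obtain ⟨φ, hφ, h⟩ := exists_lt_realDualValue_add hg hF (half_pos hε)
  obtain ⟨φ', hφ', h'⟩ := exists_lt_realDualValue_add hg hF' (half_pos hε)
  have key := realDualValue_le hg (Submodule.add_mem _ hF hF') (φ := fun i => φ i + φ' i)
    ⟨fun i => (hφ.1 i).add (hφ'.1 i), fun x => by
      simpa [Finset.sum_add_distrib] using add_le_add (hφ.2 x) (hφ'.2 x)⟩
  simp only [Pi.add_apply] at key
  simp_rw [fun i => integral_add (hφ.1 i) (hφ'.1 i), Finset.sum_add_distrib] at key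
  linarith

theorem realDualValue_smul_le (hg : ∀ i, Integrable (g i) (μ i))
    (hF : F ∈ dominated fun x : ι → X => ∑ i, g i (x i)) {c : ℝ} (hc : 0 < c) :
    realDualValue μ (c • F) ≤ c * realDualValue μ F := by
  refine le_of_forall_pos_le_add fun ε hε => ?_
  obtain ⟨φ, hφ, h⟩ := exists_lt_realDualValue_add hg hF (div_pos hε hc)
  have key := realDualValue_le hg (Submodule.smul_mem _ c hF) (φ := fun i x => c * φ i x)
    ⟨fun i => (hφ.1 i).const_mul c, fun x => by
      simpa [← Finset.mul_sum] using mul_le_mul_of_nonneg_left (hφ.2 x) hc.le⟩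
  simp_rw [integral_const_mul, ← Finset.mul_sum] at key
  have := mul_le_mul_of_nonneg_left h.le hc.le
  rw [mul_add, mul_div_cancel₀ _ hc.ne'] at this
  linarith

theorem realDualValue_smul (hg : ∀ i, Integrable (g i) (μ i))
    (hF : F ∈ dominated fun x : ι → X => ∑ i, g i (x i)) {c : ℝ} (hc : 0 < c) :
    realDualValue μ (c • F) = c * realDualValue μ F := by
  refine le_antisymm (realDualValue_smul_le hg hF hc) ?_
  have := realDualValue_smul_le hg (Submodule.smul_mem _ c hF) (inv_pos.2 hc)
  rw [smul_smul, inv_mul_cancel₀ hc.ne', one_smul] at this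
  have := mul_le_mul_of_nonneg_left this hc.le
  rwa [← mul_assoc, mul_inv_cancel₀ hc.ne', one_mul] at this

/-- The value functional `realDualValue μ` has a linear minorant on the dominated functions that
agrees with it at a prescribed `F`. -/
theorem exists_linear_le_realDualValue (hg : ∀ i, Integrable (g i) (μ i))
    (hF : F ∈ dominated fun x : ι → X => ∑ i, g i (x i)) :
    ∃ L : dominated (fun x : ι → X => ∑ i, g i (x i)) →ₗ[ℝ] ℝ,
      L ⟨F, hF⟩ = realDualValue μ F ∧ ∀ H, L H ≤ realDualValue μ (H : (ι → X) → ℝ) := by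
  set V := dominated fun x : ι → X => ∑ i, g i (x i)
  let N : V → ℝ := fun H => realDualValue μ (H : (ι → X) → ℝ)
  have N_hom : ∀ c : ℝ, 0 < c → ∀ H, N (c • H) = c * N H :=
    fun c hc H => realDualValue_smul hg H.2 hc
  have N_add : ∀ H H', N (H + H') ≤ N H + N H' := fun H H' => realDualValue_add_le hg H.2 H'.2
  have N_0 : N 0 = 0 := by
    have := N_hom 2 (by norm_num) 0
    rw [smul_zero] at this
    linarith
  let F₀ : V := ⟨F, hF⟩
  have H0 : ∀ c : ℝ, c • F₀ = 0 → (RingHom.id ℝ) c • N F₀ = 0 := by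
    intro c hc
    rcases smul_eq_zero.1 hc with rfl | h
    · simp
    · simp [h, N_0]
  obtain ⟨L, hL, hLN⟩ := exists_extension_of_le_sublinear
    (LinearPMap.mkSpanSingleton' F₀ (N F₀) H0) N N_hom N_add (by
      rintro ⟨x, hx⟩
      obtain ⟨c, rfl⟩ := Submodule.mem_span_singleton.1 hx
      rw [LinearPMap.mkSpanSingleton'_apply]
      simp only [RingHom.id_apply, smul_eq_mul]
      rcases lt_trichotomy c 0 with h | rfl | h
      -- For c < 0: 0 = N 0 ≤ N (-c • F₀) + N (c • F₀), and the first term is -c * N F₀.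
      · have h1 := N_hom (-c) (neg_pos.2 h) F₀
        have h2 := N_add ((-c) • F₀) (c • F₀)
        rw [← add_smul, neg_add_cancel, zero_smul, N_0] at h2
        linarith
      · simp [N_0]
      · exact (N_hom c h F₀).ge)
  refine ⟨L, ?_, hLN⟩
  exact (hL ⟨F₀, Submodule.mem_span_singleton_self F₀⟩).trans
    (LinearPMap.mkSpanSingleton'_apply_self _ _ _ _)

end HahnBanach

/-! ### Riesz representation on a space of dominated functions -/

section Riesz

theorem mem_dominated_of_le {Y : Type*} {G F F' : Y → ℝ} (hF' : F' ∈ dominated G)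
    (h : ∀ y, |F y| ≤ |F' y|) : F ∈ dominated G := by
  obtain ⟨C, hC⟩ := hF'
  exact ⟨C, fun y => (h y).trans (hC y)⟩

theorem self_mem_dominated {Y : Type*} {G : Y → ℝ} (hG : ∀ y, 0 ≤ G y) : G ∈ dominated G :=
  ⟨1, fun y => by rw [one_mul, abs_of_nonneg (hG y)]⟩

theorem indicator_mem_dominated {Y : Type*} {G : Y → ℝ} (hG : ∀ y, 0 ≤ G y) (s : Set Y) :
    s.indicator G ∈ dominated G :=
  mem_dominated_of_le (self_mem_dominated hG) fun y => by
    by_cases h : y ∈ s <;> simp [h]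

/-- The cutoff equal to `1` on `{G ≤ n}` and to `0` on `{n + 1 ≤ G}`. -/
def cutoff {Y : Type*} (G : Y → ℝ) (n : ℕ) (y : Y) : ℝ := max 0 (min 1 (n + 1 - G y))

variable {Y : Type*} {G : Y → ℝ}

theorem cutoff_nonneg (n : ℕ) (y : Y) : 0 ≤ cutoff G n y := le_max_left _ _

theorem cutoff_le_one (n : ℕ) (y : Y) : cutoff G n y ≤ 1 :=
  max_le zero_le_one (min_le_left _ _)

theorem cutoff_eq_one {n : ℕ} {y : Y} (h : G y ≤ n) : cutoff G n y = 1 := by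
  rw [cutoff, min_eq_left (by linarith), max_eq_right zero_le_one]

theorem cutoff_eq_zero {n : ℕ} {y : Y} (h : n + 1 ≤ G y) : cutoff G n y = 0 :=
  max_eq_left ((min_le_right _ _).trans (by linarith))

theorem cutoff_mono (y : Y) : Monotone fun n => cutoff G n y := fun m n h => by
  have : (m : ℝ) ≤ n := by exact_mod_cast h
  exact max_le_max le_rfl (min_le_min le_rfl (by linarith))

theorem eventually_cutoff_eq_one (y : Y) : ∀ᶠ n in atTop, cutoff G n y = 1 := by
  obtain ⟨N, hN⟩ := exists_nat_ge (G y)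
  filter_upwards [eventually_ge_atTop N] with n hn
  exact cutoff_eq_one (hN.trans (by exact_mod_cast hn))

variable [TopologicalSpace Y]

theorem continuous_cutoff (hG : Continuous G) (n : ℕ) : Continuous (cutoff G n) := by
  unfold cutoff
  fun_prop

theorem hasCompactSupport_mul_cutoff [R1Space Y] (hK : ∀ M : ℝ, IsCompact {y | G y ≤ M})
    (F : Y → ℝ) (n : ℕ) : HasCompactSupport fun y => F y * cutoff G n y := by
  refine HasCompactSupport.intro (hK (n + 1)) fun y hy => ?_
  rw [cutoff_eq_zero (not_le.1 hy).le, mul_zero]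

variable [T2Space Y] [LocallyCompactSpace Y] [MeasurableSpace Y] [BorelSpace Y]

/-- A positive linear functional on the functions dominated by a coercive function `G`, with
vanishing tails, is the integral against a measure on the continuous dominated functions. -/
theorem exists_measure_integral_eq (hG : Continuous G) (hG1 : ∀ y, 1 ≤ G y)
    (hK : ∀ M : ℝ, IsCompact {y | G y ≤ M}) (L : dominated G →ₗ[ℝ] ℝ)
    (hL : ∀ F : dominated G, (∀ y, 0 ≤ (F : Y → ℝ) y) → 0 ≤ L F)
    (htail : Tendsto (fun n : ℕ => L ⟨{y | (n : ℝ) ≤ G y}.indicator G,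
      indicator_mem_dominated (fun y => zero_le_one.trans (hG1 y)) _⟩) atTop (𝓝 0)) :
    ∃ γ : Measure Y, ∀ F : dominated G, Continuous (F : Y → ℝ) →
      Integrable (F : Y → ℝ) γ ∧ ∫ y, (F : Y → ℝ) y ∂γ = L F := by
  have hG0 : ∀ y, 0 ≤ G y := fun y => zero_le_one.trans (hG1 y)
  have hmono : ∀ F F' : dominated G, (∀ y, (F : Y → ℝ) y ≤ (F' : Y → ℝ) y) → L F ≤ L F' := by
    intro F F' h
    have := hL (F' - F) fun y => sub_nonneg.2 (h y)
    rw [map_sub] at this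
    linarith
  have hCc : ∀ f : CompactlySupportedContinuousMap Y ℝ, (f : Y → ℝ) ∈ dominated G := by
    intro f
    obtain ⟨C, hC⟩ := f.hasCompactSupport.exists_bound_of_continuous f.continuous
    refine ⟨C, fun y => (hC y).trans ?_⟩
    exact le_mul_of_one_le_right ((norm_nonneg _).trans (hC y)) (hG1 y)
  let Λ : CompactlySupportedContinuousMap Y ℝ →ₚ[ℝ] ℝ := PositiveLinearMap.mk₀
    { toFun := fun f => L ⟨f, hCc f⟩
      map_add' := fun f f' => by rw [← map_add]; rfl
      map_smul' := fun c f => by rw [← map_smul]; rfl }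
    fun f hf => hL _ fun y => hf y
  refine ⟨RealRMK.rieszMeasure Λ, ?_⟩
  set γ := RealRMK.rieszMeasure Λ
  have hΛ : ∀ f : CompactlySupportedContinuousMap Y ℝ, ∫ y, f y ∂γ = L ⟨f, hCc f⟩ :=
    fun f => RealRMK.integral_rieszMeasure Λ f
  have hpos : ∀ F : dominated G, Continuous (F : Y → ℝ) → (∀ y, 0 ≤ (F : Y → ℝ) y) →
      Integrable (F : Y → ℝ) γ ∧ ∫ y, (F : Y → ℝ) y ∂γ = L F := by
    rintro ⟨F, hF⟩ hFc hF0
    obtain ⟨C, hC⟩ := id hF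
    simp only at hFc hF0 ⊢
    let T : ℕ → CompactlySupportedContinuousMap Y ℝ := fun n =>
      ⟨⟨fun y => F y * cutoff G n y, hFc.mul (continuous_cutoff hG n)⟩,
        hasCompactSupport_mul_cutoff hK F n⟩
    have hT : ∀ n y, T n y = F y * cutoff G n y := fun n y => rfl
    have hT0 : ∀ n y, 0 ≤ T n y := fun n y => mul_nonneg (hF0 y) (cutoff_nonneg n y)
    have hle : ∀ n, L ⟨T n, hCc (T n)⟩ ≤ L ⟨F, hF⟩ := fun n => hmono _ _ fun y =>
      mul_le_of_le_one_right (hF0 y) (cutoff_le_one n y)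
    -- The part removed by the cutoff lives on {n ≤ G} and is at most C * G there, so the tail
    -- hypothesis controls it. This indicator is why `L` must act on discontinuous functions.
    have hge : ∀ n : ℕ, L ⟨F, hF⟩ - C * L ⟨{y | (n : ℝ) ≤ G y}.indicator G,
        indicator_mem_dominated hG0 _⟩ ≤ L ⟨T n, hCc (T n)⟩ := by
      intro n
      rw [← smul_eq_mul, ← map_smul, ← map_sub]
      refine hmono _ _ fun y => ?_
      change F y - C * {y | (n : ℝ) ≤ G y}.indicator G y ≤ F y * cutoff G n y
      by_cases h : (n : ℝ) ≤ G y
      · rw [Set.indicator_of_mem (by exact h)]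
        linarith [hT0 n y, hT n y, hC y, le_abs_self (F y)]
      · rw [Set.indicator_of_notMem (by exact h), cutoff_eq_one (not_le.1 h).le]
        simp
    have hlim : Tendsto (fun n => L ⟨T n, hCc (T n)⟩) atTop (𝓝 (L ⟨F, hF⟩)) := by
      refine tendsto_of_tendsto_of_tendsto_of_le_of_le ?_ tendsto_const_nhds hge hle
      simpa using tendsto_const_nhds.sub (htail.const_mul C)
    have hint : ∀ n, ∫⁻ y, ENNReal.ofReal (T n y) ∂γ = ENNReal.ofReal (L ⟨T n, hCc (T n)⟩) := by
      intro n
      rw [← hΛ, ofReal_integral_eq_lintegral_ofReal (T n).integrable (ae_of_all _ (hT0 n))]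
    have hmct : Tendsto (fun n => ∫⁻ y, ENNReal.ofReal (T n y) ∂γ) atTop
        (𝓝 (∫⁻ y, ENNReal.ofReal (F y) ∂γ)) := by
      refine lintegral_tendsto_of_tendsto_of_monotone
        (fun n => (T n).continuous.measurable.ennreal_ofReal.aemeasurable)
        (ae_of_all _ fun y m n h => ENNReal.ofReal_le_ofReal
          (mul_le_mul_of_nonneg_left (cutoff_mono y h) (hF0 y)))
        (ae_of_all _ fun y => tendsto_const_nhds.congr' ?_)
      filter_upwards [eventually_cutoff_eq_one (G := G) y] with n hn
      rw [hT, hn, mul_one]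
    have heq : ∫⁻ y, ENNReal.ofReal (F y) ∂γ = ENNReal.ofReal (L ⟨F, hF⟩) := by
      refine tendsto_nhds_unique hmct ?_
      simp_rw [hint]
      exact ENNReal.tendsto_ofReal hlim
    have hI : Integrable F γ := ⟨hFc.aestronglyMeasurable, by
      rw [hasFiniteIntegral_iff_ofReal (ae_of_all _ hF0), heq]
      exact ENNReal.ofReal_lt_top⟩
    refine ⟨hI, ?_⟩
    rw [integral_eq_lintegral_of_nonneg_ae (ae_of_all _ hF0) hFc.aestronglyMeasurable, heq,
      ENNReal.toReal_ofReal (hL _ hF0)]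
  rintro ⟨F, hF⟩ hFc
  obtain ⟨C, hC⟩ := id hF
  -- A signed F is the difference of the nonnegative functions F + C * G and C * G.
  let K : dominated G := C • ⟨G, self_mem_dominated hG0⟩
  obtain ⟨hKi, hKe⟩ := hpos K (hG.const_smul C) fun y => (abs_nonneg _).trans (hC y)
  obtain ⟨hSi, hSe⟩ := hpos (⟨F, hF⟩ + K) (hFc.add (hG.const_smul C)) fun y => by
    change 0 ≤ F y + C * G y
    linarith [neg_abs_le (F y), hC y]
  have hFe : F = fun y => ((⟨F, hF⟩ + K : dominated G) : Y → ℝ) y - (K : Y → ℝ) y := by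
    ext y
    simp
  constructor
  · simp only
    rw [hFe]
    exact hSi.sub hKi
  · calc ∫ y, F y ∂γ = ∫ y, ((⟨F, hF⟩ + K : dominated G) : Y → ℝ) y - (K : Y → ℝ) y ∂γ := by
          rw [← hFe]
      _ = L ⟨F, hF⟩ := by rw [integral_sub hSi hKi, hSe, hKe, map_add, add_sub_cancel_right]

end Riesz

/-! ### From the linear minorant to an optimal coupling -/

section Coupling

variable {ι X : Type*} [Fintype ι]

theorem isCompact_sum_le [TopologicalSpace X] {g : ι → X → ℝ}
    (hgc : ∀ i, Continuous (g i)) (hg0 : ∀ i x, 0 ≤ g i x)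
    (hK : ∀ i (M : ℝ), IsCompact {x | g i x ≤ M}) (M : ℝ) :
    IsCompact {x : ι → X | ∑ i, g i (x i) ≤ M} := by
  refine (isCompact_univ_pi fun i => hK i M).of_isClosed_subset
    (isClosed_le (by fun_prop) continuous_const) fun x hx i _ => ?_
  exact (Finset.single_le_sum (f := fun i => g i (x i)) (fun j _ => hg0 j (x j))
    (Finset.mem_univ i)).trans hx

/-- If the sum reaches M, its largest term is at least M / card ι, and card ι times that term bounds
the sum. The majorant is separated, hence a dual competitor for the tail. -/
theorem indicator_sum_le [Nonempty ι] {g : ι → X → ℝ} (hg0 : ∀ i x, 0 ≤ g i x) (M : ℝ)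
    (x : ι → X) :
    {y : ι → X | M ≤ ∑ i, g i (y i)}.indicator (fun y => ∑ i, g i (y i)) x ≤
      ∑ i, Fintype.card ι * {z | M / Fintype.card ι ≤ g i z}.indicator (g i) (x i) := by
  have hc : (0 : ℝ) < Fintype.card ι := by exact_mod_cast Fintype.card_pos
  have hnn : ∀ i, 0 ≤ Fintype.card ι * {z | M / Fintype.card ι ≤ g i z}.indicator (g i) (x i) :=
    fun i => mul_nonneg hc.le (Set.indicator_nonneg (fun z _ => hg0 i z) _)
  by_cases h : M ≤ ∑ i, g i (x i)
  · rw [Set.indicator_of_mem (by exact h)]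
    obtain ⟨i, -, hi⟩ := Finset.exists_max_image Finset.univ (fun i => g i (x i))
      Finset.univ_nonempty
    have hle : ∑ j, g j (x j) ≤ Fintype.card ι * g i (x i) := by
      simpa using Finset.sum_le_card_nsmul Finset.univ _ _ hi
    refine le_trans ?_ (Finset.single_le_sum (fun j _ => hnn j) (Finset.mem_univ i))
    rwa [Set.indicator_of_mem]
    rw [Set.mem_ofPred_eq, div_le_iff₀ hc, mul_comm]
    exact h.trans hle
  · rw [Set.indicator_of_notMem (by exact h)]
    exact Finset.sum_nonneg fun i _ => hnn i

theorem tendsto_integral_indicator_ge [MeasurableSpace X] {μ : Measure X} {g : X → ℝ}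
    (hgm : Measurable g) (hg : Integrable g μ) {u : ℕ → ℝ} (hu : Tendsto u atTop atTop) :
    Tendsto (fun n => ∫ x, {z | u n ≤ g z}.indicator g x ∂μ) atTop (𝓝 0) := by
  have := tendsto_integral_of_dominated_convergence (μ := μ)
    (F := fun n x => {z | u n ≤ g z}.indicator g x) (f := fun _ => 0) (fun x => ‖g x‖)
    (fun n => (hgm.indicator (measurableSet_le measurable_const hgm)).aestronglyMeasurable)
    hg.norm (fun n => ae_of_all _ fun x => norm_indicator_le_norm_self _ _)
    (ae_of_all _ fun x => tendsto_const_nhds.congr' (by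
      filter_upwards [hu.eventually_gt_atTop (g x)] with n hn
      exact (Set.indicator_of_notMem (by simpa using hn) _).symm))
  simpa using this

variable [Nonempty ι] [MetricSpace X] [ProperSpace X] [MeasurableSpace X] [BorelSpace X]
  {μ : ι → Measure X} [∀ i, IsProbabilityMeasure (μ i)] {g : ι → X → ℝ}

/-- Kantorovich duality without a dual optimizer: the dual value of a continuous dominated cost
is attained by a coupling. -/
theorem exists_coupling_integral_eq (hgc : ∀ i, Continuous (g i)) (hg1 : ∀ i x, 1 ≤ g i x)
    (hK : ∀ i (M : ℝ), IsCompact {x | g i x ≤ M}) (hg : ∀ i, Integrable (g i) (μ i))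
    {F : (ι → X) → ℝ} (hF : F ∈ dominated fun x : ι → X => ∑ i, g i (x i))
    (hFc : Continuous F) :
    ∃ γ : Measure (ι → X), IsProbabilityMeasure γ ∧ (∀ i, γ.map (fun x => x i) = μ i) ∧
      ∫ x, F x ∂γ = realDualValue μ F := by
  have hg0 : ∀ i x, 0 ≤ g i x := fun i x => zero_le_one.trans (hg1 i x)
  set G : (ι → X) → ℝ := fun x => ∑ i, g i (x i)
  obtain ⟨L, hLF, hLle⟩ : ∃ L : dominated G →ₗ[ℝ] ℝ, L ⟨F, hF⟩ = realDualValue μ F ∧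
      ∀ H : dominated G, L H ≤ realDualValue μ (H : (ι → X) → ℝ) :=
    exists_linear_le_realDualValue hg hF
  have hG1 : ∀ x, 1 ≤ G x := fun x => by
    obtain ⟨i⟩ := ‹Nonempty ι›
    exact (hg1 i (x i)).trans (Finset.single_le_sum (f := fun i => g i (x i))
      (fun j _ => hg0 j (x j)) (Finset.mem_univ i))
  have hG0 : ∀ x, 0 ≤ G x := fun x => zero_le_one.trans (hG1 x)
  have hGc : Continuous G := by fun_prop
  have hLφ : ∀ (H : dominated G) (φ : ι → X → ℝ), φ ∈ realDualClass μ (H : (ι → X) → ℝ) →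
      L H ≤ ∑ i, ∫ x, φ i x ∂(μ i) := fun H φ hφ => (hLle H).trans (realDualValue_le hg H.2 hφ)
  have hLpos : ∀ H : dominated G, (∀ y, 0 ≤ (H : (ι → X) → ℝ) y) → 0 ≤ L H := by
    intro H hH
    -- The zero tuple dominates -H, so L (-H) ≤ 0.
    have := hLφ (-H) (fun _ _ => 0) ⟨fun i => integrable_zero _ _ _, fun x => by
      simpa using hH x⟩
    simpa using this
  have htail : Tendsto (fun n : ℕ => L ⟨{y | (n : ℝ) ≤ G y}.indicator G,
      indicator_mem_dominated hG0 _⟩) atTop (𝓝 0) := by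
    have hc : (0 : ℝ) < Fintype.card ι := by exact_mod_cast Fintype.card_pos
    refine tendsto_of_tendsto_of_tendsto_of_le_of_le (h := fun n : ℕ => ∑ i, ∫ x,
      Fintype.card ι * {z | (n : ℝ) / Fintype.card ι ≤ g i z}.indicator (g i) x ∂(μ i))
      tendsto_const_nhds ?_
      (fun n => hLpos _ fun y => Set.indicator_nonneg (fun z _ => hG0 z) y)
      fun n => hLφ _ _ ⟨fun i => ?_, fun x => indicator_sum_le hg0 n x⟩
    · rw [← Finset.sum_const_zero (s := (Finset.univ : Finset ι))]
      refine tendsto_finsetSum _ fun i _ => ?_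
      simp_rw [integral_const_mul]
      rw [← mul_zero (Fintype.card ι : ℝ)]
      exact (tendsto_integral_indicator_ge (hgc i).measurable (hg i)
        (tendsto_natCast_atTop_atTop.atTop_div_const hc)).const_mul _
    · exact ((hg i).indicator (measurableSet_le measurable_const (hgc i).measurable)).const_mul _
  obtain ⟨γ, hγ⟩ := exists_measure_integral_eq hGc hG1 (isCompact_sum_le hgc hg0 hK) L hLpos htail
  have hb : ∀ {H : (ι → X) → ℝ} (C : ℝ), (∀ x, |H x| ≤ C) → H ∈ dominated G := fun C hC =>
    ⟨C, fun x => (hC x).trans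
      (le_mul_of_one_le_right ((abs_nonneg _).trans (hC x)) (hG1 x))⟩
  -- A function of one coordinate is its own separated majorant, and so is its negative; the two
  -- bounds determine `L` on it.
  have hmarg : ∀ (i : ι) (f : BoundedContinuousFunction X ℝ),
      Integrable (fun x : ι → X => f (x i)) γ ∧ ∫ x, f (x i) ∂γ = ∫ x, f x ∂(μ i) := by
    classical
    intro i f
    let H : dominated G := ⟨fun x => f (x i), hb ‖f‖ fun x => f.norm_coe_le_norm (x i)⟩
    obtain ⟨h1, h2⟩ := hγ H (by fun_prop)
    refine ⟨h1, h2.trans (le_antisymm ?_ ?_)⟩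
    · refine (hLφ H (Pi.single i f) ⟨fun j => ?_, fun x => ?_⟩).trans_eq ?_
      · rcases eq_or_ne j i with rfl | h
        · simpa using f.integrable (μ j)
        · simp [Pi.single_eq_of_ne h]
      · rw [Fintype.sum_eq_single i fun j h => by simp [Pi.single_eq_of_ne h]]
        simp [H]
      · rw [Fintype.sum_eq_single i fun j h => by simp [Pi.single_eq_of_ne h]]
        simp
    · have := hLφ (-H) (Pi.single i (-f)) ⟨fun j => ?_, fun x => ?_⟩
      · rw [Fintype.sum_eq_single i fun j h => by simp [Pi.single_eq_of_ne h], map_neg] at this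
        simp only [Pi.single_eq_same, Pi.neg_apply, integral_neg] at this
        linarith
      · rcases eq_or_ne j i with rfl | h
        · simpa using (f.integrable (μ j)).neg
        · simp [Pi.single_eq_of_ne h]
      · rw [Fintype.sum_eq_single i fun j h => by simp [Pi.single_eq_of_ne h]]
        simp [H]
  have hprob : IsProbabilityMeasure γ := by
    obtain ⟨i⟩ := ‹Nonempty ι›
    obtain ⟨h1, h2⟩ := hmarg i (BoundedContinuousFunction.const X 1)
    have : IsFiniteMeasure γ := (integrable_const_iff_isFiniteMeasure one_ne_zero).1 h1
    refine ⟨?_⟩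
    simp only [BoundedContinuousFunction.const_apply, integral_const, probReal_univ,
      smul_eq_mul, mul_one] at h2
    rwa [measureReal_def, ENNReal.toReal_eq_one_iff] at h2
  refine ⟨γ, hprob, fun i => ?_, (hγ ⟨F, hF⟩ hFc).2.trans hLF⟩
  have : IsProbabilityMeasure (γ.map fun x => x i) :=
    Measure.isProbabilityMeasure_map (measurable_pi_apply i).aemeasurable
  refine ext_of_forall_integral_eq_of_IsFiniteMeasure fun f => ?_
  rw [integral_map (measurable_pi_apply i).aemeasurable f.continuous.aestronglyMeasurable]
  exact (hmarg i f).2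

end Coupling

/-! ### Compactness of nonnegative potentials -/

section GammaLimit

variable {ι X : Type*} [Fintype ι]

theorem exists_mem_le_biInf_add {f : X → ℝ≥0∞} {s : Set X} (hs : s.Nonempty) {ε : ℝ≥0∞}
    (hε : ε ≠ 0) : ∃ x ∈ s, f x ≤ (⨅ y ∈ s, f y) + ε := by
  by_cases h : (⨅ y ∈ s, f y) = ⊤
  · obtain ⟨x, hx⟩ := hs
    exact ⟨x, hx, by simp [h]⟩
  · obtain ⟨x, hx⟩ := iInf_lt_iff.1 (ENNReal.lt_add_right h hε)
    obtain ⟨hxs, hx⟩ := iInf_lt_iff.1 hx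
    exact ⟨x, hxs, hx.le⟩

/-- The coordinates of a box vary independently, so near-minimizers can be chosen one coordinate at
a time. -/
theorem le_sum_biInf {f : ι → X → ℝ≥0∞} {s : ι → Set X} (hs : ∀ i, (s i).Nonempty) {t : ℝ≥0∞}
    (h : ∀ x : ι → X, (∀ i, x i ∈ s i) → t ≤ ∑ i, f i (x i)) :
    t ≤ ∑ i, ⨅ y ∈ s i, f i y := by
  refine ENNReal.le_of_forall_pos_le_add fun ε hε _ => ?_
  have hε' : (ε : ℝ≥0∞) / Fintype.card ι ≠ 0 := by
    simp [ENNReal.div_eq_zero_iff, hε.ne']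
  choose x hxs hx using fun i => exists_mem_le_biInf_add (f := f i) (hs i) hε'
  refine (h x hxs).trans ((Finset.sum_le_sum fun i _ => hx i).trans ?_)
  rw [Finset.sum_add_distrib, Finset.sum_const, Finset.card_univ, nsmul_eq_mul]
  gcongr
  exact ENNReal.mul_div_le

variable [TopologicalSpace X] [SecondCountableTopology X] [MeasurableSpace X]

/-- Compactness of nonnegative potentials: the lower semicontinuous relaxation of a sequence of
admissible tuples is admissible and satisfies Fatou's inequality. -/
theorem exists_lowerSemicontinuous_limit {μ : ι → Measure X} {f : ℕ → ι → X → ℝ≥0∞}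
    (hf : ∀ n i, AEMeasurable (f n i) (μ i)) {c : (ι → X) → ℝ≥0∞} (hc : LowerSemicontinuous c)
    (hcf : ∀ n x, c x ≤ ∑ i, f n i (x i)) {a : ℕ → ℝ≥0∞} {A : ℝ≥0∞}
    (hfa : ∀ n, ∑ i, ∫⁻ x, f n i x ∂(μ i) ≤ a n) (ha : Tendsto a atTop (𝓝 A)) :
    ∃ f' : ι → X → ℝ≥0∞, (∀ i, LowerSemicontinuous (f' i)) ∧ (∀ x, c x ≤ ∑ i, f' i (x i)) ∧
      ∑ i, ∫⁻ x, f' i x ∂(μ i) ≤ A := by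
  let B := TopologicalSpace.countableBasis X
  have hB : TopologicalSpace.IsTopologicalBasis B := TopologicalSpace.isBasis_countableBasis X
  have : Countable B := TopologicalSpace.countable_countableBasis X
  -- A countable power of [0, ∞] is sequentially compact, so one subsequence makes all basic infima
  -- and all integrals converge.
  let u : ℕ → ((ι × B) ⊕ ι → ℝ≥0∞) := fun n =>
    Sum.elim (fun q => ⨅ y ∈ (q.2 : Set X), f n q.1 y) fun i => ∫⁻ x, f n i x ∂(μ i)
  obtain ⟨v, σ, hσ, hv⟩ := CompactSpace.tendsto_subseq u
  rw [tendsto_pi_nhds] at hv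
  have hv1 : ∀ i (b : B), Tendsto (fun n => ⨅ y ∈ (b : Set X), f (σ n) i y) atTop
      (𝓝 (v (Sum.inl (i, b)))) := fun i b => hv (Sum.inl (i, b))
  have hv2 : ∀ i, Tendsto (fun n => ∫⁻ x, f (σ n) i x ∂(μ i)) atTop (𝓝 (v (Sum.inr i))) :=
    fun i => hv (Sum.inr i)
  -- This Γ-lower limit lies below the pointwise lower limit, as an infimum over b is at most the
  -- value at any point of b; Fatou then applies.
  refine ⟨fun i x => ⨆ (b : B) (_ : x ∈ (b : Set X)), v (Sum.inl (i, b)), ?_, ?_, ?_⟩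
  · intro i x t ht
    obtain ⟨b, hb⟩ := lt_iSup_iff.1 ht
    obtain ⟨hxb, hb⟩ := lt_iSup_iff.1 hb
    filter_upwards [(hB.isOpen b.2).mem_nhds hxb] with y hy
    exact hb.trans_le (le_iSup₂_of_le b hy le_rfl)
  · intro x
    refine le_of_forall_lt fun t ht => ?_
    obtain ⟨t', htt', ht'⟩ := exists_between ht
    -- The bound c > t' persists on a box of basic sets around x. On that box the constraint becomes
    -- one between infima, which passes to the limit.
    obtain ⟨w, hw, hws⟩ := isOpen_pi_iff'.1 (hc.isOpen_preimage t') x ht'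
    choose b hbB hxb hbw using fun i => hB.exists_subset_of_mem_open (hw i).2 (hw i).1
    have h1 : ∀ n, t' ≤ ∑ i, ⨅ y ∈ b i, f (σ n) i y := fun n =>
      le_sum_biInf (fun i => ⟨x i, hxb i⟩) fun y hy =>
        (le_of_lt (hws fun i _ => hbw i (hy i))).trans (hcf (σ n) y)
    have h2 : t' ≤ ∑ i, v (Sum.inl (i, ⟨b i, hbB i⟩)) :=
      ge_of_tendsto' (tendsto_finsetSum _ fun i _ => hv1 i ⟨b i, hbB i⟩) h1
    exact htt'.trans_le (h2.trans (Finset.sum_le_sum fun i _ =>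
      le_iSup₂_of_le (f := fun (b : B) (_ : x i ∈ (b : Set X)) => v (Sum.inl (i, b)))
        ⟨b i, hbB i⟩ (hxb i) le_rfl))
  · have hlim : ∑ i, v (Sum.inr i) ≤ A :=
      le_of_tendsto_of_tendsto' (tendsto_finsetSum _ fun i _ => hv2 i)
        (ha.comp hσ.tendsto_atTop) fun n => hfa (σ n)
    refine (Finset.sum_le_sum fun i _ => ?_).trans hlim
    calc ∫⁻ x, ⨆ (b : B) (_ : x ∈ (b : Set X)), v (Sum.inl (i, b)) ∂(μ i)
        ≤ ∫⁻ x, liminf (fun n => f (σ n) i x) atTop ∂(μ i) := by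
          refine lintegral_mono fun x => iSup₂_le fun b hb => ?_
          rw [← (hv1 i b).liminf_eq]
          exact liminf_le_liminf (Eventually.of_forall fun n => iInf₂_le x hb)
      _ ≤ liminf (fun n => ∫⁻ x, f (σ n) i x ∂(μ i)) atTop :=
          lintegral_liminf_le' fun n => hf (σ n) i
      _ = v (Sum.inr i) := (hv2 i).liminf_eq

end GammaLimit

/-! ### Lower semicontinuous potentials reaching the dual value -/

section DualAttainment

variable {ι X : Type*} [Fintype ι] [Nonempty ι]

/-- The infimum of a separated sum is the sum of the infima, here nonnegative. The shift makes every
infimum equal to their average. -/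
theorem exists_shift_nonneg [Nonempty X] {ψ : ι → X → ℝ}
    (h : ∀ x : ι → X, 0 ≤ ∑ i, ψ i (x i)) :
    ∃ a : ι → ℝ, ∑ i, a i = 0 ∧ ∀ i x, 0 ≤ ψ i x + a i := by
  classical
  have hc : (0 : ℝ) < Fintype.card ι := by exact_mod_cast Fintype.card_pos
  obtain ⟨x₀⟩ := ‹Nonempty X›
  have hbdd : ∀ i, BddBelow (Set.range (ψ i)) := by
    intro i
    refine ⟨-∑ j ∈ Finset.univ.erase i, ψ j x₀, ?_⟩
    rintro _ ⟨x, rfl⟩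
    have := h (Function.update (fun _ => x₀) i x)
    rw [← Finset.add_sum_erase _ _ (Finset.mem_univ i), Function.update_self,
      Finset.sum_congr rfl fun j hj => by
        rw [Function.update_of_ne (Finset.ne_of_mem_erase hj)]] at this
    linarith
  have hm : 0 ≤ ∑ i, ⨅ x, ψ i x := by
    refine le_of_forall_pos_le_add fun ε hε => ?_
    choose x hx using fun i => exists_lt_of_ciInf_lt
      (lt_add_of_pos_right (⨅ x, ψ i x) (div_pos hε hc))
    refine (h x).trans ((Finset.sum_le_sum fun i _ => (hx i).le).trans_eq ?_)
    rw [Finset.sum_add_distrib, Finset.sum_const, Finset.card_univ, nsmul_eq_mul,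
      mul_div_cancel₀ _ hc.ne']
  refine ⟨fun i => (∑ j, ⨅ x, ψ j x) / Fintype.card ι - ⨅ x, ψ i x, ?_, fun i x => ?_⟩
  · rw [Finset.sum_sub_distrib, Finset.sum_const, Finset.card_univ, nsmul_eq_mul,
      mul_div_cancel₀ _ hc.ne', sub_self]
  · linarith [ciInf_le (hbdd i) x, div_nonneg hm hc.le]

variable [TopologicalSpace X] [SecondCountableTopology X] [MeasurableSpace X]
  {μ : ι → Measure X} [∀ i, IsProbabilityMeasure (μ i)] {g h : ι → X → ℝ}

/-- The value `realDualValue μ F` is reached by a lower semicontinuous tuple; `h` makes the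
potentials nonnegative. -/
theorem exists_lowerSemicontinuous_potentials (hg : ∀ i, Integrable (g i) (μ i))
    {F : (ι → X) → ℝ} (hF : F ∈ dominated fun x : ι → X => ∑ i, g i (x i)) (hFc : Continuous F)
    (hhc : ∀ i, Continuous (h i)) (hh : ∀ i, Integrable (h i) (μ i))
    (hFh : ∀ x, 0 ≤ F x + ∑ i, h i (x i)) :
    ∃ f : ι → X → ℝ≥0∞, (∀ i, LowerSemicontinuous (f i)) ∧
      (∀ x, ENNReal.ofReal (F x + ∑ i, h i (x i)) ≤ ∑ i, f i (x i)) ∧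
      ∑ i, ∫⁻ x, f i x ∂(μ i) ≤ ENNReal.ofReal (realDualValue μ F + ∑ i, ∫ x, h i x ∂(μ i)) := by
  have : Nonempty X := by
    obtain ⟨i⟩ := ‹Nonempty ι›
    exact nonempty_of_isProbabilityMeasure (μ i)
  choose φ hφ hφlt using fun n : ℕ =>
    exists_lt_realDualValue_add hg hF (Nat.one_div_pos_of_nat (α := ℝ) (n := n))
  -- Constants of zero sum change neither the constraint nor the total integral.
  choose a ha0 ha using fun n => exists_shift_nonneg (ψ := fun i x => φ n i x + h i x)
    fun x => by
      rw [Finset.sum_add_distrib]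
      linarith [(hφ n).2 x, hFh x]
  have hint : ∀ n i, Integrable (fun x => φ n i x + h i x + a n i) (μ i) := fun n i =>
    (((hφ n).1 i).add (hh i)).add (integrable_const _)
  refine exists_lowerSemicontinuous_limit
    (f := fun n i x => ENNReal.ofReal (φ n i x + h i x + a n i))
    (a := fun n : ℕ => ENNReal.ofReal
      (realDualValue μ F + 1 / ((n : ℝ) + 1) + ∑ i, ∫ x, h i x ∂(μ i)))
    (fun n i => (hint n i).aemeasurable.ennreal_ofReal)
    (ENNReal.continuous_ofReal.comp (by fun_prop)).lowerSemicontinuous (fun n x => ?_) (fun n => ?_) ?_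
  · rw [← ENNReal.ofReal_sum_of_nonneg fun i _ => ha n i (x i)]
    refine ENNReal.ofReal_le_ofReal ?_
    rw [Finset.sum_add_distrib, Finset.sum_add_distrib, ha0]
    linarith [(hφ n).2 x]
  · simp_rw [fun i => (ofReal_integral_eq_lintegral_ofReal (hint n i)
      (ae_of_all _ fun x => ha n i x)).symm]
    rw [← ENNReal.ofReal_sum_of_nonneg fun i _ => integral_nonneg fun x => ha n i x]
    refine ENNReal.ofReal_le_ofReal ?_
    have : ∀ i, ∫ x, φ n i x + h i x + a n i ∂(μ i) =
        ∫ x, φ n i x ∂(μ i) + ∫ x, h i x ∂(μ i) + a n i := fun i => by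
      rw [integral_add (f := fun x => φ n i x + h i x) (((hφ n).1 i).add (hh i))
        (integrable_const _), integral_add ((hφ n).1 i) (hh i)]
      simp
    simp_rw [this, Finset.sum_add_distrib, ha0]
    linarith [hφlt n]
  · refine ENNReal.tendsto_ofReal (Tendsto.add_const _ ?_)
    simpa using tendsto_one_div_add_atTop_nhds_zero_nat.const_add (realDualValue μ F)

end DualAttainment

/-! ### Finite sums of extended reals -/

theorem EReal_sum_ne_bot {ι : Type*} {s : Finset ι} {f : ι → EReal} (h : ∀ i ∈ s, f i ≠ ⊥) :
    ∑ i ∈ s, f i ≠ ⊥ := by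
  classical
  induction s using Finset.induction_on with
  | empty => simp
  | insert a s ha ih =>
    rw [Finset.sum_insert ha, EReal.add_ne_bot_iff]
    exact ⟨h a (Finset.mem_insert_self a s), ih fun i hi => h i (Finset.mem_insert_of_mem hi)⟩

theorem EReal_sum_ne_top {ι : Type*} {s : Finset ι} {f : ι → EReal} (h : ∀ i ∈ s, f i ≠ ⊤) :
    ∑ i ∈ s, f i ≠ ⊤ := by
  classical
  induction s using Finset.induction_on with
  | empty => simp
  | insert a s ha ih =>
    rw [Finset.sum_insert ha]
    exact EReal.add_ne_top (h a (Finset.mem_insert_self a s))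
      (ih fun i hi => h i (Finset.mem_insert_of_mem hi))

theorem EReal_coe_sum {ι : Type*} (s : Finset ι) (f : ι → ℝ) :
    ((∑ i ∈ s, f i : ℝ) : EReal) = ∑ i ∈ s, (f i : EReal) := by
  classical
  induction s using Finset.induction_on with
  | empty => simp
  | insert a s ha ih => rw [Finset.sum_insert ha, Finset.sum_insert ha, EReal.coe_add, ih]

theorem EReal_coe_ennreal_sum {ι : Type*} (s : Finset ι) (f : ι → ℝ≥0∞) :
    ((∑ i ∈ s, f i : ℝ≥0∞) : EReal) = ∑ i ∈ s, (f i : EReal) := by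
  classical
  induction s using Finset.induction_on with
  | empty => simp
  | insert a s ha ih =>
    rw [Finset.sum_insert ha, Finset.sum_insert ha, EReal.coe_ennreal_add, ih]

/-! ### Conjugation with respect to the determinant -/

variable {d : ℕ}

theorem continuous_detVec : Continuous (detVec (d := d)) := by
  unfold detVec
  refine Continuous.matrix_det (continuous_matrix fun i j => ?_)
  simp only [Matrix.of_apply]
  fun_prop

/-- The conjugate of a tuple in the `i`-th variable with respect to the determinant. -/
def detConj (φ : Fin d → E d → EReal) (i : Fin d) (x : E d) : EReal :=
  ⨆ (y : Fin d → E d) (_ : y i = x),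
    (((detVec y : ℝ) : EReal) - ∑ j ∈ Finset.univ.erase i, φ j (y j))

/-- `dualClass` without the semicontinuity. -/
def Admissible (φ : Fin d → E d → EReal) : Prop :=
  (∀ i x, φ i x ≠ ⊥) ∧ ∀ x : Fin d → E d, ((detVec x : ℝ) : EReal) ≤ ∑ i, φ i (x i)

theorem detConj_le {φ : Fin d → E d → EReal} (h : Admissible φ) (i : Fin d) (x : E d) :
    detConj φ i x ≤ φ i x := by
  refine iSup₂_le fun y hy => ?_
  rw [EReal.sub_le_iff_le_add (.inl (EReal_sum_ne_bot fun j _ => h.1 j _)) (.inr (h.1 i x)), ← hy,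
    Finset.add_sum_erase _ (fun j => φ j (y j)) (Finset.mem_univ i)]
  exact h.2 y

theorem detConj_anti {φ ψ : Fin d → E d → EReal} {i : Fin d}
    (h : ∀ j ≠ i, ∀ x, φ j x ≤ ψ j x) (x : E d) : detConj ψ i x ≤ detConj φ i x :=
  iSup₂_mono fun y _ => EReal.sub_le_sub le_rfl
    (Finset.sum_le_sum fun j hj => h j (Finset.ne_of_mem_erase hj) (y j))

theorem detConj_ne_bot {φ : Fin d → E d → EReal} (hφ : ∀ i, ∃ x, φ i x ≠ ⊤) (i : Fin d)
    (x : E d) : detConj φ i x ≠ ⊥ := by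
  choose y hy using hφ
  have hle : ((detVec (Function.update y i x) : ℝ) : EReal) -
      ∑ j ∈ Finset.univ.erase i, φ j (Function.update y i x j) ≤ detConj φ i x :=
    le_iSup₂_of_le (f := fun (y : Fin d → E d) (_ : y i = x) =>
      (((detVec y : ℝ) : EReal) - ∑ j ∈ Finset.univ.erase i, φ j (y j)))
      (Function.update y i x) (Function.update_self i x y) le_rfl
  have hS : ∑ j ∈ Finset.univ.erase i, φ j (Function.update y i x j) ≠ ⊤ :=
    EReal_sum_ne_top fun j hj => by
      rw [Function.update_of_ne (Finset.ne_of_mem_erase hj)]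
      exact hy j
  refine ne_bot_of_le_ne_bot ?_ hle
  rw [sub_eq_add_neg, EReal.add_ne_bot_iff]
  exact ⟨EReal.coe_ne_bot _, by rwa [Ne, EReal.neg_eq_bot_iff]⟩

/-- With the other coordinates fixed, the expression is det minus a constant, continuous in x even
if that constant is infinite. A supremum of such functions is lower semicontinuous, whatever φ is.
-/
theorem lowerSemicontinuous_detConj (φ : Fin d → E d → EReal) (i : Fin d) :
    LowerSemicontinuous (detConj φ i) := by
  have : detConj φ i = fun x => ⨆ y : Fin d → E d,
      (((detVec (Function.update y i x) : ℝ) : EReal) -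
        ∑ j ∈ Finset.univ.erase i, φ j (y j)) := by
    ext x
    refine le_antisymm (iSup₂_le fun y hy => ?_) (iSup_le fun y => ?_)
    · refine le_iSup_of_le y ?_
      rw [← hy, Function.update_eq_self]
    · refine le_iSup₂_of_le (Function.update y i x) (Function.update_self i x y) ?_
      refine EReal.sub_le_sub le_rfl (Finset.sum_congr rfl fun j hj => ?_).le
      rw [Function.update_of_ne (Finset.ne_of_mem_erase hj)]
  rw [this]
  refine lowerSemicontinuous_iSup fun y => Continuous.lowerSemicontinuous ?_
  have hc : Continuous fun x => detVec (Function.update y i x) :=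
    continuous_detVec.comp (continuous_const.update i continuous_id)
  induction ∑ j ∈ Finset.univ.erase i, φ j (y j) with
  | bot => simpa using continuous_const
  | top => simpa using continuous_const
  | coe s =>
    simp_rw [← EReal.coe_sub]
    exact continuous_coe_real_ereal.comp (hc.sub continuous_const)

theorem Admissible.update_detConj {φ : Fin d → E d → EReal} (h : Admissible φ)
    (hφ : ∀ i, ∃ x, φ i x ≠ ⊤) (i : Fin d) :
    Admissible (Function.update φ i (detConj φ i)) := by
  refine ⟨fun j x => ?_, fun y => ?_⟩
  · rcases eq_or_ne j i with rfl | hj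
    · rw [Function.update_self]
      exact detConj_ne_bot hφ j x
    · rw [Function.update_of_ne hj]
      exact h.1 j x
  · rw [← Finset.add_sum_erase _ _ (Finset.mem_univ i), Function.update_self,
      Finset.sum_congr rfl fun j hj => by
        rw [Function.update_of_ne (Finset.ne_of_mem_erase hj)],
      ← EReal.sub_le_iff_le_add (.inl (EReal_sum_ne_bot fun j _ => h.1 j _))
        (.inr (detConj_ne_bot hφ i _))]
    exact le_iSup₂_of_le (f := fun (z : Fin d → E d) (_ : z i = y i) =>
      (((detVec z : ℝ) : EReal) - ∑ j ∈ Finset.univ.erase i, φ j (z j))) y rfl le_rfl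

/-- Below every proper admissible tuple there is an admissible tuple satisfying the conjugacy
relations. -/
theorem Admissible.exists_isConjugate_le {φ : Fin d → E d → EReal} (h : Admissible φ)
    (hφ : ∀ i, ∃ x, φ i x ≠ ⊤) :
    ∃ ψ, Admissible ψ ∧ (∀ i x, ψ i x ≤ φ i x) ∧ IsConjugate ψ := by
  suffices H : ∀ s : Finset (Fin d), ∃ ψ, Admissible ψ ∧ (∀ i x, ψ i x ≤ φ i x) ∧
      ∀ i ∈ s, ∀ x, ψ i x = detConj ψ i x by
    obtain ⟨ψ, h1, h2, h3⟩ := H Finset.univ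
    exact ⟨ψ, h1, h2, fun i x => h3 i (Finset.mem_univ i) x⟩
  intro s
  induction s using Finset.induction_on with
  | empty => exact ⟨φ, h, fun _ _ => le_rfl, by simp⟩
  | insert i s hi ih =>
    obtain ⟨ψ, h1, h2, h3⟩ := ih
    have hψ : ∀ i, ∃ x, ψ i x ≠ ⊤ := fun i => by
      obtain ⟨x, hx⟩ := hφ i
      exact ⟨x, ne_top_of_le_ne_top hx (h2 i x)⟩
    have hle : ∀ j x, Function.update ψ i (detConj ψ i) j x ≤ ψ j x := by
      intro j x
      rcases eq_or_ne j i with rfl | hj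
      · rw [Function.update_self]
        exact detConj_le h1 j x
      · rw [Function.update_of_ne hj]
    have hadm := h1.update_detConj hψ i
    refine ⟨_, hadm, fun j x => (hle j x).trans (h2 j x), fun j hj x => ?_⟩
    -- Admissibility gives one inequality. For the other, lowering potentials raises conjugates, so
    -- relations already obtained survive the update.
    refine le_antisymm ?_ (detConj_le hadm j x)
    rcases eq_or_ne j i with rfl | hji
    · rw [Function.update_self]
      exact detConj_anti (fun k hk x => by rw [Function.update_of_ne hk]) x
    · rw [Function.update_of_ne hji, h3 j (Finset.mem_of_mem_insert_of_ne hj hji)]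
      exact detConj_anti (fun k _ x => hle k x) x

theorem IsConjugate.mem_dualClass {φ : Fin d → E d → EReal} (hc : IsConjugate φ)
    (h : Admissible φ) : φ ∈ dualClass d := by
  refine ⟨fun i => ?_, h⟩
  rw [show φ i = detConj φ i from funext (hc i)]
  exact lowerSemicontinuous_detConj φ i

/-! ### Weak duality and the cost of a tuple -/

section Costs

variable {μ : Fin d → Measure (E d)}

/-- Weak duality. -/
theorem integral_detVec_le_dualCost {γ : Measure (Fin d → E d)} (hγ : γ ∈ couplings μ)
    (hI : Integrable detVec γ) {φ : Fin d → E d → EReal} (hφ : φ ∈ dualClass d) :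
    ((∫ x, detVec x ∂γ : ℝ) : EReal) ≤ dualCost μ φ := by
  unfold dualCost
  split_ifs with hpos
  · exact le_top
  have hm : ∀ i, Measurable fun x => (φ i x).toENNReal :=
    fun i => (hφ.1 i).measurable.ereal_toENNReal
  have hmn : ∀ i, Measurable fun x => (-φ i x).toENNReal :=
    fun i => (hφ.1 i).measurable.neg.ereal_toENNReal
  have hcomp : ∀ (i : Fin d) {u : E d → ℝ≥0∞}, Measurable u →
      Measurable fun x : Fin d → E d => u (x i) := fun i _ hu => hu.comp (measurable_pi_apply i)
  have hmarg : ∀ (i : Fin d) {u : E d → ℝ≥0∞}, Measurable u →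
      ∫⁻ x, u x ∂(μ i) = ∫⁻ x, u (x i) ∂γ := fun i u hu => by
    rw [← hγ.2 i, lintegral_map hu (measurable_pi_apply i)]
  have hP : posCost μ φ = ∫⁻ x, ∑ i, (φ i (x i)).toENNReal ∂γ := by
    rw [lintegral_finsetSum _ fun i _ => hcomp i (hm i)]
    exact Finset.sum_congr rfl fun i _ => hmarg i (hm i)
  have hN : negCost μ φ = ∫⁻ x, ∑ i, (-φ i (x i)).toENNReal ∂γ := by
    rw [lintegral_finsetSum _ fun i _ => hcomp i (hmn i)]
    exact Finset.sum_congr rfl fun i _ => hmarg i (hmn i)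
  -- The constraint with all negative parts moved across, so that it can be integrated in [0, ∞]
  -- without subtraction.
  have hpt : ∀ x : Fin d → E d, ENNReal.ofReal (detVec x) + ∑ i, (-φ i (x i)).toENNReal ≤
      ∑ i, (φ i (x i)).toENNReal + ENNReal.ofReal (-detVec x) := by
    intro x
    by_cases htop : ∃ i, φ i (x i) = ⊤
    · obtain ⟨i, hi⟩ := htop
      have : ∑ i, (φ i (x i)).toENNReal = ⊤ :=
        ENNReal.sum_eq_top.2 ⟨i, Finset.mem_univ i, by simp [hi]⟩
      simp [this]
    · push Not at htop
      have hr : ∀ i, φ i (x i) = ((φ i (x i)).toReal : EReal) := fun i =>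
        (EReal.coe_toReal (htop i) (hφ.2.1 i _)).symm
      have hle := hφ.2.2 x
      generalize hrr : (fun i => (φ i (x i)).toReal) = r at *
      have hr' : ∀ i, φ i (x i) = (r i : EReal) := fun i => by rw [hr i, ← hrr]
      simp_rw [hr', ← EReal.coe_neg, EReal.real_coe_toENNReal] at hle ⊢
      rw [← EReal_coe_sum, EReal.coe_le_coe_iff] at hle
      simp_rw [ENNReal.ofReal, ← ENNReal.ofNNReal_finsetSum, ← ENNReal.coe_add,
        ENNReal.coe_le_coe, ← NNReal.coe_le_coe]
      push_cast
      simp_rw [Real.coe_toNNReal']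
      have h1 : ∀ t : ℝ, max t 0 = max (-t) 0 + t := fun t => by
        rcases le_total t 0 with h | h
        · rw [max_eq_right h, max_eq_left (by linarith)]; ring
        · rw [max_eq_left h, max_eq_right (by linarith)]; ring
      rw [Finset.sum_congr rfl fun i _ => h1 (r i), Finset.sum_add_distrib, h1 (detVec x)]
      linarith
  have hint := lintegral_mono (μ := γ) hpt
  have hdm : Measurable (detVec (d := d)) := continuous_detVec.measurable
  have hdn : Measurable fun x : Fin d → E d => ENNReal.ofReal (-detVec x) :=
    hdm.neg.ennreal_ofReal
  rw [lintegral_add_left hdm.ennreal_ofReal, lintegral_add_right _ hdn,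
    ← hP, ← hN] at hint
  rw [integral_eq_lintegral_pos_part_sub_lintegral_neg_part hI]
  have hA : ∫⁻ x, ENNReal.ofReal (detVec x) ∂γ ≠ ⊤ := hI.lintegral_lt_top.ne
  have hB : ∫⁻ x, ENNReal.ofReal (-detVec x) ∂γ ≠ ⊤ := hI.neg.lintegral_lt_top.ne
  have hneg : negCost μ φ ≠ ⊤ :=
    ne_top_of_le_ne_top (ENNReal.add_ne_top.2 ⟨hpos, hB⟩) (le_add_self.trans hint)
  rw [← EReal.coe_ennreal_toReal hpos, ← EReal.coe_ennreal_toReal hneg, ← EReal.coe_sub,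
    EReal.coe_le_coe_iff]
  have := ENNReal.toReal_mono (ENNReal.add_ne_top.2 ⟨hpos, hB⟩) hint
  rw [ENNReal.toReal_add hA hneg, ENNReal.toReal_add hpos hB] at this
  linarith

/-- Carries Fatou's bound on f back to φ ≤ f - h: integrate φ⁺ + h ≤ f + φ⁻ and cancel ∫ h. The sign
condition `hP` keeps `ENNReal.ofReal` from truncating. -/
theorem dualCost_le {φ : Fin d → E d → EReal} (hφ : ∀ i, Measurable (φ i))
    {f : Fin d → E d → ℝ≥0∞} {h : Fin d → E d → ℝ}
    (hhm : ∀ i, Measurable (h i)) (hh0 : ∀ i x, 0 ≤ h i x) (hh : ∀ i, Integrable (h i) (μ i))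
    (hle : ∀ i x, φ i x ≤ (f i x : EReal) - (h i x : EReal)) {P : ℝ}
    (hP : 0 ≤ P + ∑ i, ∫ x, h i x ∂(μ i))
    (hf : ∑ i, ∫⁻ x, f i x ∂(μ i) ≤ ENNReal.ofReal (P + ∑ i, ∫ x, h i x ∂(μ i))) :
    dualCost μ φ ≤ P := by
  have h1 : ∀ i x, (φ i x).toENNReal ≤ f i x := fun i x => by
    refine (EReal.toENNReal_le_toENNReal (hle i x)).trans ?_
    refine (EReal.toENNReal_le_toENNReal (y := (f i x : EReal)) ?_).trans (by simp)
    refine (EReal.sub_le_sub le_rfl (EReal.coe_nonneg.2 (hh0 i x))).trans ?_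
    simp
  have h2 : ∀ i x, (φ i x).toENNReal + ENNReal.ofReal (h i x) ≤
      f i x + (-φ i x).toENNReal := fun i x => by
    have hl := hle i x
    generalize hft : f i x = t at hl ⊢
    rcases eq_or_ne t ⊤ with rfl | ht
    · simp
    lift t to NNReal using ht
    induction hr : φ i x with
    | bot => simp
    | top =>
      rw [hr] at hl
      have : ((t : ℝ≥0∞) : EReal) - (h i x : EReal) = ((t - h i x : ℝ) : EReal) := by
        push_cast; rfl
      rw [this, top_le_iff] at hl
      exact absurd hl (EReal.coe_ne_top _)
    | coe r =>
      rw [hr] at hl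
      have : ((t : ℝ≥0∞) : EReal) - (h i x : EReal) = ((t - h i x : ℝ) : EReal) := by
        push_cast; rfl
      rw [this, EReal.coe_le_coe_iff] at hl
      rw [← EReal.coe_neg, EReal.real_coe_toENNReal, EReal.real_coe_toENNReal]
      simp_rw [ENNReal.ofReal, ← ENNReal.coe_add, ENNReal.coe_le_coe, ← NNReal.coe_le_coe]
      push_cast
      simp_rw [Real.coe_toNNReal']
      rw [max_eq_left (hh0 i x)]
      rcases le_total r 0 with h | h
      · rw [max_eq_right h, max_eq_left (by linarith)]; linarith
      · rw [max_eq_left h, max_eq_right (by linarith)]; linarith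
  have hpos : posCost μ φ ≠ ⊤ :=
    ne_top_of_le_ne_top ENNReal.ofReal_ne_top
      ((Finset.sum_le_sum fun i _ => lintegral_mono (h1 i)).trans hf)
  rw [dualCost, if_neg hpos]
  by_cases hneg : negCost μ φ = ⊤
  · rw [hneg, EReal.coe_ennreal_top, EReal.sub_top]
    exact bot_le
  have hH : ∀ i, ∫⁻ x, ENNReal.ofReal (h i x) ∂(μ i) = ENNReal.ofReal (∫ x, h i x ∂(μ i)) :=
    fun i => (ofReal_integral_eq_lintegral_ofReal (hh i) (ae_of_all _ (hh0 i))).symm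
  have hH0 : ∀ i, 0 ≤ ∫ x, h i x ∂(μ i) := fun i => integral_nonneg (hh0 i)
  have key : posCost μ φ + ENNReal.ofReal (∑ i, ∫ x, h i x ∂(μ i)) ≤
      ENNReal.ofReal (P + ∑ i, ∫ x, h i x ∂(μ i)) + negCost μ φ := by
    refine le_trans ?_ (add_le_add_left hf _)
    rw [ENNReal.ofReal_sum_of_nonneg fun i _ => hH0 i]
    simp_rw [← hH]
    rw [posCost, negCost, ← Finset.sum_add_distrib, ← Finset.sum_add_distrib]
    refine Finset.sum_le_sum fun i _ => ?_
    have hn : Measurable fun x => (-φ i x).toENNReal := (hφ i).neg.ereal_toENNReal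
    rw [← lintegral_add_right _ (hhm i).ennreal_ofReal, ← lintegral_add_right _ hn]
    exact lintegral_mono (h2 i)
  rw [← EReal.coe_ennreal_toReal hpos, ← EReal.coe_ennreal_toReal hneg, ← EReal.coe_sub,
    EReal.coe_le_coe_iff]
  have := ENNReal.toReal_mono (ENNReal.add_ne_top.2 ⟨ENNReal.ofReal_ne_top, hneg⟩) key
  rw [ENNReal.toReal_add hpos ENNReal.ofReal_ne_top, ENNReal.toReal_add ENNReal.ofReal_ne_top hneg,
    ENNReal.toReal_ofReal hP,
    ENNReal.toReal_ofReal (Finset.sum_nonneg fun i _ => hH0 i)] at this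
  linarith

end Costs

/-! ### Growth of the determinant and moment bounds -/

/-- Leibniz expansion: each of the d! terms is at most the product of the norms. The constant is not
sharp, but only integrability depends on it. -/
theorem abs_detVec_le (x : Fin d → E d) : |detVec x| ≤ d.factorial * ∏ i, ‖x i‖ := by
  rw [detVec, Matrix.det_apply']
  refine (Finset.abs_sum_le_sum_abs _ _).trans ?_
  have : ∀ σ ∈ (Finset.univ : Finset (Equiv.Perm (Fin d))),
      |((Equiv.Perm.sign σ : ℤ) : ℝ) * ∏ i, Matrix.of (fun i j : Fin d => x j i) (σ i) i| ≤
        ∏ i, ‖x i‖ := by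
    intro σ _
    rw [abs_mul, Finset.abs_prod]
    have hs : |((Equiv.Perm.sign σ : ℤ) : ℝ)| = 1 := by
      rcases Int.units_eq_one_or (Equiv.Perm.sign σ) with h | h <;> simp [h]
    rw [hs, one_mul]
    exact Finset.prod_le_prod (fun i _ => abs_nonneg _) fun i _ => PiLp.norm_apply_le (x i) (σ i)
  refine (Finset.sum_le_card_nsmul _ _ _ this).trans_eq ?_
  rw [Finset.card_univ, Fintype.card_perm, Fintype.card_fin, nsmul_eq_mul]

/-- Young's inequality for finitely many factors. -/
theorem prod_le_sum_rpow_div {ι : Type*} (s : Finset ι) {p z : ι → ℝ} (hp : ∀ i ∈ s, 0 < p i)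
    (hsum : ∑ i ∈ s, 1 / p i = 1) (hz : ∀ i ∈ s, 0 ≤ z i) :
    ∏ i ∈ s, z i ≤ ∑ i ∈ s, z i ^ p i / p i := by
  have := Real.geom_mean_le_arith_mean_weighted s (fun i => 1 / p i) (fun i => z i ^ p i)
    (fun i hi => (one_div_pos.2 (hp i hi)).le) hsum fun i hi => Real.rpow_nonneg (hz i hi) _
  refine le_trans (Finset.prod_congr rfl fun i hi => ?_).le
    (this.trans (Finset.sum_congr rfl fun i _ => ?_).le)
  · rw [← Real.rpow_mul (hz i hi), mul_one_div_cancel (hp i hi).ne', Real.rpow_one]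
  · rw [one_div, inv_mul_eq_div]

/-- The separated majorant of the determinant. -/
def moment (p : Fin d → ℝ) (i : Fin d) (x : E d) : ℝ := d.factorial * (‖x‖ ^ p i / p i)

theorem abs_detVec_le_sum_moment {p : Fin d → ℝ} (hp : ∀ i, 1 < p i)
    (hsum : ∑ i, 1 / p i = 1) (x : Fin d → E d) : |detVec x| ≤ ∑ i, moment p i (x i) := by
  simp_rw [moment, ← Finset.mul_sum]
  exact (abs_detVec_le x).trans (mul_le_mul_of_nonneg_left
    (prod_le_sum_rpow_div _ (fun i _ => zero_lt_one.trans (hp i)) hsum fun i _ => norm_nonneg _)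
    (Nat.cast_nonneg _))

theorem moment_nonneg {p : Fin d → ℝ} (hp : ∀ i, 1 < p i) (i : Fin d) (x : E d) :
    0 ≤ moment p i x :=
  mul_nonneg (Nat.cast_nonneg _)
    (div_nonneg (Real.rpow_nonneg (norm_nonneg _) _) (zero_lt_one.trans (hp i)).le)

theorem continuous_moment {p : Fin d → ℝ} (hp : ∀ i, 1 < p i) (i : Fin d) :
    Continuous (moment p i) :=
  continuous_const.mul ((continuous_norm.rpow_const fun _ =>
    .inr (zero_lt_one.trans (hp i)).le).div_const _)

theorem isCompact_one_add_moment_le {p : Fin d → ℝ} (hp : ∀ i, 1 < p i) (i : Fin d) (M : ℝ) :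
    IsCompact {x : E d | 1 + moment p i x ≤ M} := by
  have hp0 : 0 < p i := zero_lt_one.trans (hp i)
  have hf : (0 : ℝ) < d.factorial := by exact_mod_cast d.factorial_pos
  have htend : Tendsto (fun x : E d => 1 + moment p i x) (cocompact (E d)) atTop :=
    tendsto_atTop_add_const_left _ _ ((((tendsto_rpow_atTop hp0).comp
      tendsto_norm_cocompact_atTop).atTop_div_const hp0).const_mul_atTop hf)
  obtain ⟨K, hK, hKM⟩ := mem_cocompact.1 (htend.eventually (eventually_gt_atTop M))
  refine hK.of_isClosed_subset
    (isClosed_le (continuous_const.add (continuous_moment hp i)) continuous_const) fun x hx => ?_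
  by_contra h
  have h1 : M < 1 + moment p i x := hKM h
  have h2 : 1 + moment p i x ≤ M := hx
  exact h1.not_ge h2

theorem integrable_detVec {μ : Fin d → Measure (E d)} {p : Fin d → ℝ} (hp : ∀ i, 1 < p i)
    (hsum : ∑ i, 1 / p i = 1) (hm : ∀ i, Integrable (moment p i) (μ i))
    {γ : Measure (Fin d → E d)} (hγ : γ ∈ couplings μ) : Integrable detVec γ := by
  refine Integrable.mono' (g := fun x => ∑ i, moment p i (x i))
    (integrable_finsetSum _ fun i _ => ?_) continuous_detVec.aestronglyMeasurable
    (ae_of_all _ fun x => abs_detVec_le_sum_moment hp hsum x)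
  have := hm i
  rw [← hγ.2 i] at this
  exact this.comp_measurable (measurable_pi_apply i)

end DetTransport

end

/-! ### Assembly of the duality theorem -/

theorem mainTheorem1 {d : ℕ}
    (μ : Fin d → MeasureTheory.Measure (DetTransport.E d))
    (hμ : ∀ i, MeasureTheory.IsProbabilityMeasure (μ i))
    (p : Fin d → ℝ) (hp : ∀ i, 1 < p i) (hsum : ∑ i, 1 / p i = 1)
    (hmom : ∀ i, MeasureTheory.Integrable (fun x : DetTransport.E d => ‖x‖ ^ p i / p i) (μ i)) :
    (∀ γ ∈ DetTransport.couplings μ, MeasureTheory.Integrable DetTransport.detVec γ) ∧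
    (∃ γ, DetTransport.IsMKSolution μ γ) ∧
    (∃ φ, DetTransport.IsDualSolution μ φ) ∧
    DetTransport.mkValue μ = DetTransport.dualValue μ ∧
    ∃ φ, DetTransport.IsDualSolution μ φ ∧ DetTransport.IsConjugate φ := by
  open MeasureTheory DetTransport in
  have hhi : ∀ i, Integrable (moment p i) (μ i) := fun i => (hmom i).const_mul _
  have hI : ∀ γ ∈ couplings μ, Integrable detVec γ := fun γ hγ =>
    integrable_detVec hp hsum hhi hγ
  -- For d = 0 the empty sum of the 1 / p i would be 0.
  have hne : Nonempty (Fin d) := by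
    by_contra h
    rw [not_nonempty_iff] at h
    simp at hsum
  have hhc := fun i => continuous_moment hp i
  have hh0 := fun i x => moment_nonneg hp i x
  have hdet := fun x => abs_detVec_le_sum_moment hp hsum x
  have hgi : ∀ i, Integrable (fun x => 1 + moment p i x) (μ i) := fun i =>
    (integrable_const 1).add (hhi i)
  -- The added 1 makes the majorant at least 1, so that bounded functions are dominated too.
  have hF : detVec (d := d) ∈
      dominated fun x : Fin d → E d => ∑ i, (1 + moment p i (x i)) := by
    refine ⟨1, fun x => (hdet x).trans ?_⟩
    rw [one_mul]
    exact Finset.sum_le_sum fun i _ => by linarith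
  obtain ⟨γ, hγp, hγm, hγv⟩ := exists_coupling_integral_eq (μ := μ)
    (g := fun i x => 1 + moment p i x)
    (fun i => continuous_const.add (hhc i)) (fun i x => by linarith [hh0 i x])
    (isCompact_one_add_moment_le hp) hgi hF continuous_detVec
  have hγ : γ ∈ couplings μ := ⟨hγp, hγm⟩
  have hFh : ∀ x : Fin d → E d, 0 ≤ detVec x + ∑ i, moment p i (x i) := fun x => by
    linarith [hdet x, neg_abs_le (detVec x)]
  obtain ⟨f, hflsc, hfF, hfint⟩ := exists_lowerSemicontinuous_potentials (μ := μ) hgi hF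
    continuous_detVec hhc hhi hFh
  have hval0 : 0 ≤ realDualValue μ detVec + ∑ i, ∫ x, moment p i x ∂(μ i) := by
    have hcomp : ∀ i, Integrable (fun x : Fin d → E d => moment p i (x i)) γ := fun i => by
      have := hhi i
      rw [← hγm i] at this
      exact this.comp_measurable (measurable_pi_apply i)
    have hmi : ∀ i, ∫ x, moment p i x ∂(μ i) = ∫ x, moment p i (x i) ∂γ := fun i => by
      rw [← hγm i, integral_map (measurable_pi_apply i).aemeasurable
        (hhc i).aestronglyMeasurable]
    rw [← hγv, Finset.sum_congr rfl fun i _ => hmi i, ← integral_finsetSum _ fun i _ => hcomp i,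
      ← integral_add (hI γ hγ) (integrable_finsetSum _ fun i _ => hcomp i)]
    exact integral_nonneg hFh
  have hadm : Admissible fun i x => (f i x : EReal) - (moment p i x : EReal) := by
    refine ⟨fun i x => ?_, fun x => ?_⟩
    · simp only [sub_eq_add_neg]
      rw [EReal.add_ne_bot_iff, ← EReal.coe_neg]
      exact ⟨EReal.coe_ennreal_ne_bot _, EReal.coe_ne_bot _⟩
    · have h1 := EReal.coe_ennreal_le_coe_ennreal_iff.2 (hfF x)
      rw [EReal.coe_ennreal_ofReal, max_eq_left (hFh x), EReal_coe_ennreal_sum, EReal.coe_add]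
        at h1
      have h2 := EReal.sub_le_sub h1 (le_refl ((∑ i, moment p i (x i) : ℝ) : EReal))
      rw [EReal.add_sub_cancel_right] at h2
      refine h2.trans_eq ?_
      simp_rw [sub_eq_add_neg, ← EReal.coe_neg]
      rw [Finset.sum_add_distrib, ← EReal_coe_sum, Finset.sum_neg_distrib]
  -- A finite integral forces f i to be finite somewhere.
  have hproper : ∀ i, ∃ x, (f i x : EReal) - (moment p i x : EReal) ≠ ⊤ := by
    intro i
    have hfin : ∫⁻ x, f i x ∂(μ i) ≠ ⊤ := ne_top_of_le_ne_top ENNReal.ofReal_ne_top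
      ((Finset.single_le_sum (f := fun i => ∫⁻ x, f i x ∂(μ i)) (fun _ _ => zero_le)
        (Finset.mem_univ i)).trans hfint)
    obtain ⟨x, hx⟩ := (ae_lt_top (hflsc i).measurable hfin).exists
    refine ⟨x, ?_⟩
    rw [sub_eq_add_neg, ← EReal.coe_neg]
    exact EReal.add_ne_top (by simpa using hx.ne) (EReal.coe_ne_top _)
  obtain ⟨φ, hφa, hφle, hφc⟩ := hadm.exists_isConjugate_le hproper
  have hφd : φ ∈ dualClass d := hφc.mem_dualClass hφa
  have hcost : dualCost μ φ ≤ realDualValue μ detVec :=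
    dualCost_le (fun i => (hφd.1 i).measurable) (fun i => (hhc i).measurable) hh0 hhi hφle hval0
      hfint
  have hle_mk : ((∫ x, detVec x ∂γ : ℝ) : EReal) ≤ mkValue μ :=
    le_iSup₂_of_le (f := fun (γ : Measure (Fin d → E d)) (_ : γ ∈ couplings μ) =>
      ((∫ x, detVec x ∂γ : ℝ) : EReal)) γ hγ le_rfl
  have hweak : mkValue μ ≤ dualValue μ := iSup₂_le fun γ hγ => le_iInf₂ fun φ hφ =>
    integral_detVec_le_dualCost hγ (hI γ hγ) hφ
  have hdual_le : dualValue μ ≤ dualCost μ φ :=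
    iInf₂_le_of_le (f := fun φ (_ : φ ∈ dualClass d) => dualCost μ φ) φ hφd le_rfl
  rw [← hγv] at hcost
  have hφs : IsDualSolution μ φ :=
    ⟨hφd, le_antisymm (hcost.trans (hle_mk.trans hweak)) hdual_le⟩
  exact ⟨hI, ⟨γ, hγ, le_antisymm hle_mk (hweak.trans (hdual_le.trans hcost))⟩, ⟨φ, hφs⟩,
    le_antisymm hweak (hdual_le.trans (hcost.trans hle_mk)), φ, hφs, hφc⟩
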